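/- For $f\colon\{0,1\}^n\times\{0,1\}^n\to\{0,1\}$ and a probability distribution $\mu$ on $\{0,1\}^n\times\{0,1\}^n$, let $C_\rho(f,\mu)$ be the least number of bits exchanged in the worst case by a deterministic two-party communication protocol whose output (determined by the transcript) differs from $f(x,y)$ with probability at most $(1-\rho)/2$ when $(x,y)\sim\mu$. Let $C^\oplus_\rho(f,\mu)$ be defined in the same way, except that at the end Alice and Bob only output bits $a$ and $b$, each computed from the transcript and the player's own input, and $a\oplus b$ counts as the output. Let $\beta^*(f,\mu)$ be the largest bias of the XOR game $(f,\mu)$ for players who share a quantum state and do not communicate: on input $(x,y)\sim\mu$ Alice and Bob measure their parts of a shared finite-dimensional bipartite state, answer with bits $a$ and $b$, respectively, and win if and only if $a\oplus b=f(x,y)$; the supremum of the winning probabilities is $(1+\beta^*(f,\mu))/2$. For $\ell\ge1$ and $x,y\in\{0,1\}^{\ell n}$, split into consecutive blocks $x^{(1)},\dots,x^{(\ell)}$ and $y^{(1)},\dots,y^{(\ell)}$ of length $n$, let $f^{\oplus\ell}(x,y)=\bigoplus_{i=1}^{\ell}f(x^{(i)},y^{(i)})$ and $\mu^{\otimes\ell}(x,y)=\prod_{i=1}^{\ell}\mu(x^{(i)},y^{(i)})$.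 Then, for every $n$, every such $f$ and $\mu$, every integer $\ell\ge 1$ and every $\rho\in(0,1]$, one has $\beta^*(f,\mu)>0$ and $$\frac1\ell\, C_{\rho^\ell}(f^{\oplus\ell},\mu^{\otimes\ell})\ \ge\ 2\log_2\frac{\rho}{\beta^*(f,\mu)},$$ and the same inequality holds with $C^\oplus_{\rho^\ell}$ in place of $C_{\rho^\ell}$. -/

import Mathlib

open scoped ComplexOrder Kronecker

/-- Bit strings of length `n`. -/
abbrev BitString (n : ℕ) : Type := Fin n → Bool

/-! ### Deterministic two-party communication protocols -/

/-- A deterministic two-party protocol tree on inputs `x : X` (Alice) and `y : Y` (Bob).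
At an inner node one of the players sends one bit, which depends on that player's own input
(and on the node, i.e. on the transcript so far); a leaf carries an element of `O`. -/
inductive Protocol (X Y O : Type) : Type
  | leaf (o : O) : Protocol X Y O
  | alice (msg : X → Bool) (next : Bool → Protocol X Y O) : Protocol X Y O
  | bob (msg : Y → Bool) (next : Bool → Protocol X Y O) : Protocol X Y O

namespace Protocol

variable {X Y O : Type}

/-- The content of the leaf which is reached on input `(x, y)`. -/
def run : Protocol X Y O → X → Y → O
  | leaf o, _, _ => o
  | alice msg next, x, y => (next (msg x)).run x y
  | bob msg next, x, y => (next (msg y)).run x y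

/-- The cost of a protocol: the number of bits exchanged in the worst case. -/
def cost : Protocol X Y O → ℕ
  | leaf _ => 0
  | alice _ next => max (next false).cost (next true).cost + 1
  | bob _ next => max (next false).cost (next true).cost + 1

end Protocol

/-- The probability, for `(x, y)` distributed according to `μ`, that `g x y ≠ f x y`. -/
noncomputable def errorProb {X Y : Type} [Fintype X] [Fintype Y]
    (g f : X → Y → Bool) (μ : X × Y → ℝ) : ℝ :=
  ∑ x : X, ∑ y : Y, if g x y ≠ f x y then μ (x, y) else 0

/-- `C_ρ(f, μ)`: the least number of bits exchanged by a deterministic protocol whose output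
(the label of the leaf, hence determined by the transcript) differs from `f` with probability
at most `(1 - ρ) / 2` under `μ`. -/
noncomputable def commComplexity {X Y : Type} [Fintype X] [Fintype Y]
    (ρ : ℝ) (f : X → Y → Bool) (μ : X × Y → ℝ) : ℕ :=
  sInf {k : ℕ | ∃ P : Protocol X Y Bool,
    P.cost = k ∧ errorProb P.run f μ ≤ (1 - ρ) / 2}

/-- `C^⊕_ρ(f, μ)`: as `commComplexity`, but at the end Alice and Bob only have to output bits
`a` and `b`, each depending on the transcript and on the own input, such that `a ⊕ b` is the
value of `f`. -/
noncomputable def xorCommComplexity {X Y : Type} [Fintype X] [Fintype Y]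
    (ρ : ℝ) (f : X → Y → Bool) (μ : X × Y → ℝ) : ℕ :=
  sInf {k : ℕ | ∃ P : Protocol X Y ((X → Bool) × (Y → Bool)),
    P.cost = k ∧
      errorProb (fun x y => xor ((P.run x y).1 x) ((P.run x y).2 y)) f μ ≤ (1 - ρ) / 2}

/-! ### XOR games with shared quantum states -/

/-- A quantum strategy for a two-player game with one-bit answers and without communication:
a shared (possibly mixed) state on `ℂ^dA ⊗ ℂ^dB`, and for each input of a player a two-outcome
measurement (POVM) on that player's part. -/
structure QuantumStrategy (X Y : Type) : Type where
  /-- dimension of Alice's system -/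
  dA : ℕ
  /-- dimension of Bob's system -/
  dB : ℕ
  /-- the shared density matrix -/
  state : Matrix (Fin dA × Fin dB) (Fin dA × Fin dB) ℂ
  state_posSemidef : state.PosSemidef
  state_trace : state.trace = 1
  /-- Alice's measurements -/
  measA : X → Bool → Matrix (Fin dA) (Fin dA) ℂ
  measA_posSemidef : ∀ x a, (measA x a).PosSemidef
  measA_sum : ∀ x, ∑ a, measA x a = 1
  /-- Bob's measurements -/
  measB : Y → Bool → Matrix (Fin dB) (Fin dB) ℂ
  measB_posSemidef : ∀ y b, (measB y b).PosSemidef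
  measB_sum : ∀ y, ∑ b, measB y b = 1

namespace QuantumStrategy

variable {X Y : Type}

/-- The probability `p(a, b | x, y)` of the answers `a`, `b` on inputs `x`, `y` (Born rule). -/
noncomputable def prob (S : QuantumStrategy X Y) (a b : Bool) (x : X) (y : Y) : ℝ :=
  (S.state * (S.measA x a ⊗ₖ S.measB y b)).trace.re

/-- The probability that `a ⊕ b = f x y` when `(x, y)` is distributed according to `μ`. -/
noncomputable def winProb [Fintype X] [Fintype Y] (S : QuantumStrategy X Y)
    (f : X → Y → Bool) (μ : X × Y → ℝ) : ℝ :=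
  ∑ x : X, ∑ y : Y, μ (x, y) *
    ∑ a : Bool, ∑ b : Bool, if xor a b = f x y then S.prob a b x y else 0

end QuantumStrategy

/-- `β*(f, μ)`: the largest bias `2 p - 1`, where `p` is the winning probability of a quantum
strategy in the XOR game `(f, μ)`. -/
noncomputable def quantumBias {X Y : Type} [Fintype X] [Fintype Y]
    (f : X → Y → Bool) (μ : X × Y → ℝ) : ℝ :=
  ⨆ S : QuantumStrategy X Y, (2 * S.winProb f μ - 1)

/-! ### XOR of independent copies -/

/-- The `i`-th of the `ℓ` consecutive blocks of length `n` of a string of length `ℓ n`: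
its `j`-th entry is the entry of `x` at position `j + n i` (counted from `0`). -/
def block {n ℓ : ℕ} (x : BitString (ℓ * n)) (i : Fin ℓ) : BitString n :=
  fun j => x (finProdFinEquiv (i, j))

/-- `f^{⊕ ℓ}`: the XOR of the values of `f` on the `ℓ` blocks. -/
def xorPow {n : ℕ} (f : BitString n → BitString n → Bool) (ℓ : ℕ) :
    BitString (ℓ * n) → BitString (ℓ * n) → Bool :=
  fun x y => (List.ofFn fun i : Fin ℓ => f (block x i) (block y i)).foldr xor false

/-- `μ^{⊗ ℓ}`: the distribution of `ℓ` independent blocks, each distributed as `μ`. -/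
def tensorPow {n : ℕ} (μ : BitString n × BitString n → ℝ) (ℓ : ℕ) :
    BitString (ℓ * n) × BitString (ℓ * n) → ℝ :=
  fun p => ∏ i : Fin ℓ, μ (block p.1 i, block p.2 i)

/-! ### Weighted bounds for bilinear forms -/

/-! Put `G x y = μ (x, y) * (-1) ^ f x y`. Unit vectors maximizing `∑ G x y ⟪u x, v y⟫` are realized
by a quantum strategy (Tsirelson), so their value `β` is at most `quantumBias f μ`. Only this half
of Tsirelson's theorem is needed.

Optimality yields dual weights `a`, `b`, each of total `β`, for which the form of `G` is bounded by
the product of the weighted `ℓ²`-norms (`exists_unit_vectors_and_dual`). A Gram factorization makes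
this bound multiplicative: the `ℓ`-th tensor power satisfies it with the product weights, of total
`β ^ ℓ` (`FormBound.tensorPow_of_gram`).

Each communicated bit splits the rows or the columns in two and loses at most a factor `√2`, while
local output signs lose nothing (`Protocol.formBound`). At the all-ones vectors this bounds the
correlation of a cost-`c` protocol with `f^{⊕ ℓ}` by `√2 ^ c * β ^ ℓ`. The allowed error forces the
correlation to be at least `ρ ^ ℓ`; logarithms finish the proof. -/

/-- The bilinear form of `G` is bounded by `r` with respect to the weighted `ℓ²`-norms
given by `a` and `b`. -/
def FormBound {X Y : Type} [Fintype X] [Fintype Y] (G : X → Y → ℝ) (a : X → ℝ) (b : Y → ℝ)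
    (r : ℝ) : Prop :=
  ∀ (s : X → ℝ) (t : Y → ℝ), ∑ x, ∑ y, G x y * (s x * t y) ≤
    r * (√(∑ x, a x * s x ^ 2) * √(∑ y, b y * t y ^ 2))

theorem sqrt_add_sqrt_le (p q : ℝ) (hp : 0 ≤ p) (hq : 0 ≤ q) : √p + √q ≤ √2 * √(p + q) := by
  rw [← Real.sqrt_mul (by norm_num)]
  apply Real.le_sqrt_of_sq_le
  nlinarith [Real.sq_sqrt hp, Real.sq_sqrt hq, sq_nonneg (√p - √q)]

section Protocols

variable {X Y O : Type} [Fintype X] [Fintype Y] {G : X → Y → ℝ} {a : X → ℝ} {b : Y → ℝ}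

theorem FormBound.mono {r r' : ℝ} (h : FormBound G a b r) (hr : r ≤ r') : FormBound G a b r' :=
  fun s t => (h s t).trans (by gcongr)

theorem FormBound.swap {r : ℝ} (h : FormBound G a b r) : FormBound (fun y x => G x y) b a r := by
  intro t s
  rw [Finset.sum_comm, mul_comm (√_)]
  refine le_trans (le_of_eq ?_) (h s t)
  simp only [mul_comm (t _)]

/-- Splitting the rows of a matrix into two classes costs a factor `√2`. -/
theorem FormBound.ite {r : ℝ} (hr : 0 ≤ r) (ha : ∀ x, 0 ≤ a x) {M : Bool → X → Y → ℝ}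
    (h : ∀ c, FormBound (M c) a b r) (msg : X → Bool) :
    FormBound (fun x y => M (msg x) x y) a b (r * √2) := by
  intro s t
  -- The message classes partition the rows, so truncating `s` to each class splits its weighted
  -- squared norm as `p + q`.
  have h0 := h false (fun x => if msg x = false then s x else 0) t
  have h1 := h true (fun x => if msg x = true then s x else 0) t
  set p := ∑ x, a x * (if msg x = false then s x else 0) ^ 2
  set q := ∑ x, a x * (if msg x = true then s x else 0) ^ 2
  have hp : 0 ≤ p := Finset.sum_nonneg fun x _ => mul_nonneg (ha x) (sq_nonneg _)
  have hq : 0 ≤ q := Finset.sum_nonneg fun x _ => mul_nonneg (ha x) (sq_nonneg _)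
  have hpq : ∑ x, a x * s x ^ 2 = p + q := by
    rw [← Finset.sum_add_distrib]
    refine Finset.sum_congr rfl fun x _ => ?_
    cases msg x <;> simp
  have hsum : ∑ x, ∑ y, M (msg x) x y * (s x * t y) =
      (∑ x, ∑ y, M false x y * ((if msg x = false then s x else 0) * t y)) +
      ∑ x, ∑ y, M true x y * ((if msg x = true then s x else 0) * t y) := by
    rw [← Finset.sum_add_distrib]
    refine Finset.sum_congr rfl fun x _ => ?_
    cases msg x <;> simp
  rw [hsum, hpq]
  have hs := sqrt_add_sqrt_le p q hp hq
  have hN := Real.sqrt_nonneg (∑ y, b y * t y ^ 2)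
  calc _ ≤ r * (√p * √(∑ y, b y * t y ^ 2)) + r * (√q * √(∑ y, b y * t y ^ 2)) :=
        add_le_add h0 h1
    _ = r * ((√p + √q) * √(∑ y, b y * t y ^ 2)) := by ring
    _ ≤ r * ((√2 * √(p + q)) * √(∑ y, b y * t y ^ 2)) := by gcongr
    _ = _ := by ring

/-- The rank-one factor is absorbed into the test vectors, whose weighted norms do not grow. -/
theorem FormBound.mul_rankOne {r : ℝ} (hr : 0 ≤ r) (ha : ∀ x, 0 ≤ a x) (hb : ∀ y, 0 ≤ b y)
    (h : FormBound G a b r) {α : X → ℝ} {β : Y → ℝ}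
    (hα : ∀ x, α x ^ 2 ≤ 1) (hβ : ∀ y, β y ^ 2 ≤ 1) :
    FormBound (fun x y => G x y * (α x * β y)) a b r := by
  intro s t
  have h1 := h (fun x => α x * s x) (fun y => β y * t y)
  calc _ = ∑ x, ∑ y, G x y * (α x * s x * (β y * t y)) := by
        refine Finset.sum_congr rfl fun x _ => Finset.sum_congr rfl fun y _ => by ring
    _ ≤ _ := h1
    _ ≤ _ := by
        have e1 : ∀ x, a x * (α x * s x) ^ 2 ≤ a x * s x ^ 2 := fun x => by
          rw [mul_pow]
          exact mul_le_mul_of_nonneg_left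
            (mul_le_of_le_one_left (sq_nonneg _) (hα x)) (ha x)
        have e2 : ∀ y, b y * (β y * t y) ^ 2 ≤ b y * t y ^ 2 := fun y => by
          rw [mul_pow]
          exact mul_le_mul_of_nonneg_left
            (mul_le_of_le_one_left (sq_nonneg _) (hβ y)) (hb y)
        exact mul_le_mul_of_nonneg_left (mul_le_mul
          (Real.sqrt_le_sqrt (Finset.sum_le_sum fun x _ => e1 x))
          (Real.sqrt_le_sqrt (Finset.sum_le_sum fun y _ => e2 y))
          (Real.sqrt_nonneg _) (Real.sqrt_nonneg _)) hr

/-- A protocol of cost `c` whose players finally output signs multiplies the bound of a bilinear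
form by at most `√2 ^ c`. -/
theorem Protocol.formBound (ha : ∀ x, 0 ≤ a x) (hb : ∀ y, 0 ≤ b y)
    (hG : FormBound G a b 1) {α : O → X → ℝ} {β : O → Y → ℝ}
    (hα : ∀ o x, α o x ^ 2 ≤ 1) (hβ : ∀ o y, β o y ^ 2 ≤ 1) (P : Protocol X Y O) :
    FormBound (fun x y => G x y * (α (P.run x y) x * β (P.run x y) y)) a b (√2 ^ P.cost) := by
  have h2 : 1 ≤ √2 := Real.one_le_sqrt.2 (by norm_num)
  induction P with
  | leaf o =>
    simpa [Protocol.run, Protocol.cost] using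
      hG.mul_rankOne zero_le_one ha hb (hα o) (hβ o)
  | alice msg next ih =>
    rw [Protocol.cost, pow_succ]
    refine FormBound.ite (M := fun c x y => G x y *
      (α ((next c).run x y) x * β ((next c).run x y) y)) (by positivity) ha (fun c => ?_) msg
    refine (ih c).mono (pow_le_pow_right₀ h2 ?_)
    cases c <;> simp
  | bob msg next ih =>
    rw [Protocol.cost, pow_succ]
    -- Bob's message splits columns, which are rows of the transposed form.
    refine (FormBound.ite (M := fun c y x => G x y *
      (α ((next c).run x y) x * β ((next c).run x y) y)) (by positivity) hb (fun c => ?_) msg).swap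
    refine ((ih c).mono (pow_le_pow_right₀ h2 ?_)).swap
    cases c <;> simp

end Protocols

/-- An error-free protocol is needed because `sInf ∅ = 0` in `ℕ`: the complexities are attained only
if some protocol is admissible. -/
theorem Protocol.exists_run_eq {X Y O : Type} [Fintype X] (g : X → Y → Bool) (e : Bool → O) :
    ∃ P : Protocol X Y O, ∀ x y, P.run x y = e (g x y) := by
  classical
  suffices ∀ s : Finset X, ∃ P : Protocol X Y O, ∀ x ∈ s, ∀ y, P.run x y = e (g x y) by
    simpa using this Finset.univ
  intro s
  induction s using Finset.induction_on with
  | empty => exact ⟨.leaf (e false), by simp⟩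
  | insert z s _ ih =>
    obtain ⟨P, hP⟩ := ih
    -- Alice announces whether her input is `z`; if so, Bob can compute the value alone.
    refine ⟨.alice (fun x => decide (x = z))
      (fun c => if c then .bob (g z) (fun d => .leaf (e d)) else P), fun x hx y => ?_⟩
    by_cases hxz : x = z
    · subst hxz
      simp [Protocol.run]
    · simpa [Protocol.run, hxz] using hP x ((Finset.mem_insert.1 hx).resolve_left hxz) y

/-! ### Tensor powers of bilinear forms -/

/-- Cauchy–Schwarz for `∑ s x • g x` and `∑ t y • h y`; `key` is Pythagoras for an orthogonal
family. -/
theorem sum_mul_le_sqrt_mul_sqrt_of_gram {X' Y' K : Type} [Fintype X'] [Fintype Y'] [Fintype K]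
    (g : X' → K → ℝ) (h : Y' → K → ℝ) {A : X' → ℝ} {B : Y' → ℝ}
    (hA : ∀ x x', x ≠ x' → ∑ k, g x k * g x' k = 0) (hA' : ∀ x, ∑ k, g x k * g x k = A x)
    (hB : ∀ y y', y ≠ y' → ∑ k, h y k * h y' k = 0) (hB' : ∀ y, ∑ k, h y k * h y k = B y) :
    FormBound (fun x y => ∑ k, g x k * h y k) A B 1 := by
  have key : ∀ {Z : Type} [Fintype Z] (g : Z → K → ℝ) (A : Z → ℝ)
      (_ : ∀ x x', x ≠ x' → ∑ k, g x k * g x' k = 0) (_ : ∀ x, ∑ k, g x k * g x k = A x)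
      (s : Z → ℝ), ∑ k, (∑ x, s x * g x k) ^ 2 = ∑ x, A x * s x ^ 2 := by
    intro Z _ g A h1 h2 s
    calc ∑ k, (∑ x, s x * g x k) ^ 2
        = ∑ x, ∑ x', s x * s x' * ∑ k, g x k * g x' k := by
          simp_rw [sq, Finset.sum_mul_sum, Finset.mul_sum]
          rw [Finset.sum_comm]
          refine Finset.sum_congr rfl fun x _ => ?_
          rw [Finset.sum_comm]
          refine Finset.sum_congr rfl fun x' _ => Finset.sum_congr rfl fun k _ => by ring
      _ = _ := by
          refine Finset.sum_congr rfl fun x _ => ?_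
          rw [Finset.sum_eq_single x, h2 x]
          · ring
          · intro x' _ hx'
            rw [h1 x x' (Ne.symm hx'), mul_zero]
          · simp
  intro s t
  rw [one_mul, ← key g A hA hA' s, ← key h B hB hB' t]
  calc _ = ∑ k, (∑ x, s x * g x k) * (∑ y, t y * h y k) := by
        simp_rw [Finset.sum_mul_sum]
        symm
        rw [Finset.sum_comm]
        refine Finset.sum_congr rfl fun x _ => ?_
        rw [Finset.sum_comm]
        refine Finset.sum_congr rfl fun y _ => ?_
        rw [Finset.sum_mul]
        refine Finset.sum_congr rfl fun k _ => by ring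
    _ ≤ _ := Real.sum_mul_le_sqrt_mul_sqrt _ _ _

/-- The tensor power of a bilinear form. -/
theorem FormBound.tensorPow_of_gram {X Y K ι X' Y' : Type} [Fintype K] [Fintype ι] [DecidableEq ι]
    [Fintype X'] [Fintype Y']
    (g : X → K → ℝ) (h : Y → K → ℝ) {a : X → ℝ} {b : Y → ℝ}
    (hA : ∀ x x', x ≠ x' → ∑ k, g x k * g x' k = 0) (hA' : ∀ x, ∑ k, g x k * g x k = a x)
    (hB : ∀ y y', y ≠ y' → ∑ k, h y k * h y' k = 0) (hB' : ∀ y, ∑ k, h y k * h y k = b y)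
    {φ : X' → ι → X} (hφ : Function.Injective φ) {ψ : Y' → ι → Y} (hψ : Function.Injective ψ) :
    FormBound (fun x y => ∏ i, ∑ k, g (φ x i) k * h (ψ y i) k)
      (fun x => ∏ i, a (φ x i)) (fun y => ∏ i, b (ψ y i)) 1 := by
  -- Inner products of tensor products of vectors factor over the coordinates.
  have key : ∀ {X Y X' Y' : Type} (g : X → K → ℝ) (h : Y → K → ℝ) (φ : X' → ι → X)
      (ψ : Y' → ι → Y) (x : X') (y : Y'),
      ∑ k : ι → K, (∏ i, g (φ x i) (k i)) * (∏ i, h (ψ y i) (k i)) =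
        ∏ i, ∑ k, g (φ x i) k * h (ψ y i) k := by
    intro X Y X' Y' g h φ ψ x y
    simp_rw [← Finset.prod_mul_distrib]
    rw [Finset.prod_univ_sum, Fintype.piFinset_univ]
  have := sum_mul_le_sqrt_mul_sqrt_of_gram (K := ι → K)
    (fun x k => ∏ i, g (φ x i) (k i)) (fun y k => ∏ i, h (ψ y i) (k i))
    (A := fun x => ∏ i, a (φ x i)) (B := fun y => ∏ i, b (ψ y i)) ?_ ?_ ?_ ?_
  · simpa only [key] using this
  · intro x x' hx
    -- Distinct indices differ in some coordinate, where the factor vanishes.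
    obtain ⟨i, hi⟩ := Function.ne_iff.1 (hφ.ne hx)
    rw [key]
    exact Finset.prod_eq_zero (Finset.mem_univ i) (hA _ _ hi)
  · intro x
    rw [key]
    simp only [hA']
  · intro x x' hx
    obtain ⟨i, hi⟩ := Function.ne_iff.1 (hψ.ne hx)
    rw [key]
    exact Finset.prod_eq_zero (Finset.mem_univ i) (hB _ _ hi)
  · intro x
    rw [key]
    simp only [hB']

/-! ### Optimal vectors of an XOR game and the dual solution -/

open scoped MatrixOrder in
theorem Matrix.PosSemidef.exists_eq_conjTranspose_mul_self {𝕜 I : Type} [RCLike 𝕜] [Fintype I]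
    {M : Matrix I I 𝕜} (hM : M.PosSemidef) : ∃ B : Matrix I I 𝕜, M = B.conjTranspose * B := by
  classical
  exact CStarAlgebra.nonneg_iff_eq_star_mul_self.1 hM.nonneg

section Dual

open Filter Topology

variable {X Y : Type} [Fintype X] [Fintype Y]

theorem exists_unit_orthogonal {Z E : Type} [Fintype Z] [NormedAddCommGroup E]
    [InnerProductSpace ℝ E] [FiniteDimensional ℝ E] (hd : Fintype.card Z < Module.finrank ℝ E)
    (w : Z → E) : ∃ e : E, ‖e‖ = 1 ∧ ∀ z, inner ℝ (w z) e = 0 := by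
  set W := Submodule.span ℝ (Set.range w)
  have hW : W ≠ ⊤ := by
    intro h
    have h1 := finrank_range_le_card (R := ℝ) w
    rw [Set.finrank] at h1
    change Module.finrank ℝ W ≤ _ at h1
    rw [h, finrank_top] at h1
    omega
  have hW' : Wᗮ ≠ ⊥ := fun h => hW (Submodule.orthogonal_eq_bot_iff.1 h)
  obtain ⟨v, hv, hv0⟩ := Submodule.exists_mem_ne_zero_of_ne_bot hW'
  refine ⟨(‖v‖⁻¹ : ℝ) • v, norm_smul_inv_norm (𝕜 := ℝ) hv0, fun z => ?_⟩
  rw [inner_smul_right, (Submodule.mem_orthogonal W v).1 hv _ (Submodule.subset_span ⟨z, rfl⟩),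
    mul_zero]

theorem hasDerivAt_sqrt_one_sub (r : ℝ) :
    HasDerivAt (fun δ : ℝ => √(1 - δ * r ^ 2)) (-(r ^ 2) / 2) 0 := by
  have h : HasDerivAt (fun δ : ℝ => 1 - δ * r ^ 2) (-(r ^ 2)) 0 := by
    simpa using ((hasDerivAt_id (0 : ℝ)).mul_const (r ^ 2)).const_sub 1
  simpa using h.sqrt (by simp)

/-- One-sided, since the perturbation it serves involves `√δ` and makes sense only for `δ ≥ 0`. -/
theorem nonpos_of_hasDerivAt_of_eventually_le {Φ : ℝ → ℝ} {d : ℝ} (h : HasDerivAt Φ d 0)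
    (hle : ∀ᶠ δ in 𝓝[>] (0 : ℝ), Φ δ ≤ Φ 0) : d ≤ 0 := by
  have h1 := (hasDerivWithinAt_iff_tendsto_slope' (s := Set.Ioi (0 : ℝ)) (by simp)).1
    h.hasDerivWithinAt
  refine le_of_tendsto h1 ?_
  filter_upwards [hle, self_mem_nhdsWithin] with δ h2 h3
  rw [slope_def_field]
  exact div_nonpos_of_nonpos_of_nonneg (by linarith) (by simpa using le_of_lt h3)

/-- The second-order optimality condition for unit vectors which maximize a bilinear form, in a
space with a spare dimension. -/
theorem quadratic_le_of_isMax {E : Type} [NormedAddCommGroup E]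
    [InnerProductSpace ℝ E] [FiniteDimensional ℝ E]
    (hd : Fintype.card (X ⊕ Y) < Module.finrank ℝ E) (G : X → Y → ℝ) (w : X ⊕ Y → E)
    (hw : ∀ z, ‖w z‖ = 1)
    (hmax : ∀ w' : X ⊕ Y → E, (∀ z, ‖w' z‖ = 1) →
      ∑ x, ∑ y, G x y * inner ℝ (w' (.inl x)) (w' (.inr y)) ≤
        ∑ x, ∑ y, G x y * inner ℝ (w (.inl x)) (w (.inr y)))
    (s : X → ℝ) (t : Y → ℝ) :
    2 * ∑ x, ∑ y, G x y * (s x * t y) ≤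
      ∑ x, (∑ y, G x y * inner ℝ (w (.inl x)) (w (.inr y))) * s x ^ 2 +
      ∑ y, (∑ x, G x y * inner ℝ (w (.inl x)) (w (.inr y))) * t y ^ 2 := by
  obtain ⟨e, he, hwe⟩ := exists_unit_orthogonal hd w
  have hew : ∀ z, inner ℝ e (w z) = 0 := fun z => by rw [real_inner_comm, hwe]
  set r : X ⊕ Y → ℝ := Sum.elim s t
  -- Each vector is rotated towards the common orthogonal direction `e`. The step length is `√δ`, so
  -- the second-order condition in the step becomes a first-order one in `δ`.
  let w' : ℝ → X ⊕ Y → E := fun δ z => √(1 - δ * r z ^ 2) • w z + (√δ * r z) • e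
  let Φ : ℝ → ℝ := fun δ => ∑ x, ∑ y, G x y *
    (√(1 - δ * s x ^ 2) * √(1 - δ * t y ^ 2) * inner ℝ (w (.inl x)) (w (.inr y)) +
      δ * (s x * t y))
  have hinner : ∀ δ, 0 ≤ δ → ∀ z z', inner ℝ (w' δ z) (w' δ z') =
      √(1 - δ * r z ^ 2) * √(1 - δ * r z' ^ 2) * inner ℝ (w z) (w z') + δ * (r z * r z') := by
    intro δ hδ z z'
    simp only [w', inner_add_left, inner_add_right, inner_smul_left, inner_smul_right, hwe, hew,
      real_inner_self_eq_norm_sq, he]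
    simp only [conj_trivial]
    linear_combination (r z * r z') * Real.mul_self_sqrt hδ
  have hder : HasDerivAt Φ (∑ x, ∑ y, G x y *
      ((-(s x ^ 2) / 2 - t y ^ 2 / 2) * inner ℝ (w (.inl x)) (w (.inr y)) + s x * t y)) 0 := by
    refine HasDerivAt.fun_sum fun x _ => HasDerivAt.fun_sum fun y _ =>
      HasDerivAt.const_mul _ (HasDerivAt.add (HasDerivAt.mul_const ?_ _) ?_)
    · refine ((hasDerivAt_sqrt_one_sub (s x)).mul (hasDerivAt_sqrt_one_sub (t y))).congr_deriv ?_
      simp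
      ring
    · simpa using (hasDerivAt_id (0 : ℝ)).mul_const (s x * t y)
  have hev : ∀ᶠ δ in 𝓝[>] (0 : ℝ), Φ δ ≤ Φ 0 := by
    have h1 : ∀ᶠ δ in 𝓝 (0 : ℝ), ∀ z, δ * r z ^ 2 < 1 := by
      rw [eventually_all]
      intro z
      have : Tendsto (fun δ : ℝ => δ * r z ^ 2) (𝓝 0) (𝓝 (0 * r z ^ 2)) :=
        tendsto_id.mul_const _
      exact this.eventually_lt_const (by simp)
    filter_upwards [nhdsWithin_le_nhds h1, self_mem_nhdsWithin] with δ h2 h3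
    have h3 : 0 ≤ δ := le_of_lt h3
    have hn : ∀ z, ‖w' δ z‖ = 1 := by
      intro z
      rw [← sq_eq_sq₀ (norm_nonneg _) zero_le_one, ← real_inner_self_eq_norm_sq, hinner δ h3,
        real_inner_self_eq_norm_sq, hw, Real.mul_self_sqrt (by linarith [h2 z])]
      ring
    have h4 := hmax _ hn
    simp only [hinner δ h3] at h4
    simpa [Φ, r] using h4
  have hfin := nonpos_of_hasDerivAt_of_eventually_le hder hev
  have e1 : ∑ y, (∑ x, G x y * inner ℝ (w (.inl x)) (w (.inr y))) * t y ^ 2 =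
      ∑ x, ∑ y, G x y * inner ℝ (w (.inl x)) (w (.inr y)) * t y ^ 2 := by
    rw [Finset.sum_comm]
    simp only [Finset.sum_mul]
  rw [e1]
  simp only [Finset.sum_mul]
  rw [Finset.mul_sum, ← Finset.sum_add_distrib, ← sub_nonpos, ← Finset.sum_sub_distrib]
  calc _ = 2 * ∑ x, ∑ y, G x y *
      ((-(s x ^ 2) / 2 - t y ^ 2 / 2) * inner ℝ (w (.inl x)) (w (.inr y)) + s x * t y) := by
        rw [Finset.mul_sum]
        refine Finset.sum_congr rfl fun x _ => ?_
        rw [Finset.mul_sum, Finset.mul_sum, ← Finset.sum_add_distrib, ← Finset.sum_sub_distrib]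
        refine Finset.sum_congr rfl fun y _ => by ring
    _ ≤ 0 := by linarith

/-- Strong duality for the semidefinite program of an XOR game. -/
theorem exists_unit_vectors_and_dual (G : X → Y → ℝ) :
    ∃ (N : ℕ) (u : X → EuclideanSpace ℝ (Fin N)) (v : Y → EuclideanSpace ℝ (Fin N))
      (a : X → ℝ) (b : Y → ℝ),
      (∀ x, ‖u x‖ = 1) ∧ (∀ y, ‖v y‖ = 1) ∧
      ∑ x, a x = ∑ x, ∑ y, G x y * inner ℝ (u x) (v y) ∧
      ∑ y, b y = ∑ x, ∑ y, G x y * inner ℝ (u x) (v y) ∧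
      ∀ (s : X → ℝ) (t : Y → ℝ), 2 * ∑ x, ∑ y, G x y * (s x * t y) ≤
        ∑ x, a x * s x ^ 2 + ∑ y, b y * t y ^ 2 := by
  -- One dimension more than there are vectors leaves room for `e`.
  set N := Fintype.card (X ⊕ Y) + 1
  let E := EuclideanSpace ℝ (Fin N)
  have hK : IsCompact (Set.univ.pi fun _ : X ⊕ Y => Metric.sphere (0 : E) 1) :=
    isCompact_univ_pi fun _ => isCompact_sphere _ _
  have hne : (Set.univ.pi fun _ : X ⊕ Y => Metric.sphere (0 : E) 1).Nonempty :=
    ⟨fun _ => EuclideanSpace.single 0 1, fun _ _ => by simp [E]⟩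
  obtain ⟨w, hw, hmax⟩ := hK.exists_isMaxOn hne
    (f := fun w => ∑ x, ∑ y, G x y * inner ℝ (w (.inl x)) (w (.inr y))) (by fun_prop)
  -- The weights left as `_` are the row and column sums of `G x y * ⟪w x, w y⟫`, hence both totals
  -- equal the optimum.
  refine ⟨N, fun x => w (.inl x), fun y => w (.inr y), _, _, fun x => by simpa using hw (.inl x),
    fun y => by simpa using hw (.inr y), ?_, ?_,
    quadratic_le_of_isMax (by rw [finrank_euclideanSpace_fin]; exact Nat.lt_succ_self _) G w (fun z => by simpa using hw z)
      (fun w' hw' => hmax (fun z _ => by simpa using hw' z))⟩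
  · rfl
  · exact Finset.sum_comm

/-- Weights with the bound on the quadratic form are squared norms of orthogonal families of
vectors which have the entries of `G` as inner products. -/
theorem exists_gram_of_quadratic_le {G : X → Y → ℝ} {a : X → ℝ} {b : Y → ℝ}
    (h : ∀ (s : X → ℝ) (t : Y → ℝ), 2 * ∑ x, ∑ y, G x y * (s x * t y) ≤
        ∑ x, a x * s x ^ 2 + ∑ y, b y * t y ^ 2) :
    ∃ (g : X → X ⊕ Y → ℝ) (k : Y → X ⊕ Y → ℝ),
      (∀ x x', x ≠ x' → ∑ z, g x z * g x' z = 0) ∧ (∀ x, ∑ z, g x z * g x z = a x) ∧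
      (∀ y y', y ≠ y' → ∑ z, k y z * k y' z = 0) ∧ (∀ y, ∑ z, k y z * k y z = b y) ∧
      ∀ x y, ∑ z, g x z * k y z = G x y := by
  classical
  set M : Matrix (X ⊕ Y) (X ⊕ Y) ℝ :=
    Matrix.fromBlocks (Matrix.diagonal a) (Matrix.of G) (Matrix.of G).transpose
      (Matrix.diagonal b) with hMdef
  have hM : M.PosSemidef := by
    refine .of_dotProduct_mulVec_nonneg ?_ fun r => ?_
    · rw [Matrix.IsHermitian, hMdef, Matrix.fromBlocks_conjTranspose]
      simp [Matrix.conjTranspose_eq_transpose_of_trivial]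
    -- The sign change turns the upper bound on the form into positivity of `M`.
    · have h1 := h (fun x => r (.inl x)) (fun y => - r (.inr y))
      have e1 : star r ⬝ᵥ M.mulVec r = ∑ x, a x * r (.inl x) ^ 2 +
          ∑ y, b y * r (.inr y) ^ 2 + 2 * ∑ x, ∑ y, G x y * (r (.inl x) * r (.inr y)) := by
        have e2 : ∑ y, ∑ x, G x y * (r (.inl x) * r (.inr y)) =
          ∑ x, ∑ y, G x y * (r (.inl x) * r (.inr y)) := Finset.sum_comm
        rw [two_mul]
        nth_rw 2 [← e2]
        simp only [dotProduct, Matrix.mulVec, Fintype.sum_sum_type, hMdef, Matrix.fromBlocks_apply₁₁,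
          Matrix.fromBlocks_apply₁₂, Matrix.fromBlocks_apply₂₁, Matrix.fromBlocks_apply₂₂,
          Matrix.diagonal_apply, Matrix.transpose_apply, Matrix.of_apply, ite_mul, zero_mul,
          Finset.sum_ite_eq, Finset.mem_univ, if_true, mul_add, Finset.sum_add_distrib,
          Pi.star_apply, star_trivial]
        have : ∀ (p q r s p' q' r' s' : ℝ), p = p' → q = q' → r = r' → s = s' →
          p + q + (r + s) = p' + s' + (r' + q') := by intros; subst_vars; ring
        apply this <;> refine Finset.sum_congr rfl fun _ _ => ?_
        · ring
        · rw [Finset.mul_sum]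
          refine Finset.sum_congr rfl fun _ _ => by ring
        · rw [Finset.mul_sum]
          refine Finset.sum_congr rfl fun _ _ => by ring
        · ring
      rw [e1]
      simp only [mul_neg, Finset.sum_neg_distrib, neg_sq] at h1
      linarith
  obtain ⟨B, hB⟩ := hM.exists_eq_conjTranspose_mul_self
  have hB' : ∀ i j, ∑ z, B z i * B z j = M i j := fun i j => by
    rw [hB]; simp [Matrix.mul_apply]
  refine ⟨fun x z => B z (.inl x), fun y z => B z (.inr y), ?_, ?_, ?_, ?_, ?_⟩
  · intro x x' hx
    simp [hB', hMdef, hx]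
  · intro x
    simp [hB', hMdef]
  · intro x x' hx
    simp [hB', hMdef, hx]
  · intro x
    simp [hB', hMdef]
  · intro x y
    simp [hB', hMdef]

end Dual

/-! ### Quantum strategies from unit vectors -/

/-- The sign `(-1) ^ b`. -/
def bitSign (b : Bool) : ℝ := if b then -1 else 1

theorem bitSign_xor (a b : Bool) : bitSign (xor a b) = bitSign a * bitSign b := by
  cases a <;> cases b <;> simp [bitSign]

theorem bitSign_sq (a : Bool) : bitSign a ^ 2 = 1 := by
  cases a <;> simp [bitSign]

theorem exists_clifford_of_fintype (n : ℕ) : ∃ (I : Type) (_ : Fintype I) (_ : DecidableEq I)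
    (_ : Nonempty I) (Γ : (Fin n → ℝ) →ₗ[ℝ] Matrix I I ℂ),
    (∀ u, (Γ u).IsHermitian) ∧ ∀ u, Γ u * Γ u = (((∑ i, u i ^ 2 : ℝ) : ℂ)) • 1 := by
  induction n with
  | zero =>
    exact ⟨Unit, inferInstance, inferInstance, inferInstance, 0, by simp, by simp⟩
  | succ n ih =>
    obtain ⟨I, _, _, _, Γ, h1, h2⟩ := ih
    -- The new generator is `diag(1, -1)`; the old ones become off-diagonal and anticommute with it.
    let F : (Fin (n + 1) → ℝ) →ₗ[ℝ] Matrix (I ⊕ I) (I ⊕ I) ℂ :=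
      { toFun := fun u => Matrix.fromBlocks ((u 0 : ℂ) • 1) (Γ (fun i => u i.succ))
          (Γ (fun i => u i.succ)) (-((u 0 : ℂ) • 1))
        map_add' := fun u v => by
          rw [Matrix.fromBlocks_add, ← map_add]
          congr 1 <;> simp [add_smul, add_comm]
        map_smul' := fun c u => by
          rw [Matrix.fromBlocks_smul, RingHom.id_apply, ← map_smul]
          congr 1 <;> ext i j <;> simp [mul_assoc] }
    refine ⟨I ⊕ I, inferInstance, inferInstance, inferInstance, F, fun u => ?_, fun u => ?_⟩
    · have h3 := h1 (fun i => u i.succ)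
      refine Matrix.IsHermitian.fromBlocks ?_ h3 ?_
      · simp [Matrix.IsHermitian, Matrix.conjTranspose_smul]
      · simp [Matrix.IsHermitian, Matrix.conjTranspose_smul]
    · change Matrix.fromBlocks _ _ _ _ * Matrix.fromBlocks _ _ _ _ = _
      rw [Matrix.fromBlocks_multiply, h2, ← Matrix.fromBlocks_one, Matrix.fromBlocks_smul]
      rw [Fin.sum_univ_succ]
      congr 1
      · simp only [Complex.ofReal_add, add_smul, Complex.ofReal_mul,
          Matrix.mul_smul, mul_one, smul_smul, sq]
      · simp
      · simp
      · rw [neg_mul_neg, add_comm]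
        simp only [Complex.ofReal_add, add_smul, Complex.ofReal_mul,
          Matrix.mul_smul, mul_one, smul_smul, sq]

/-- Generators of a Clifford algebra as Hermitian matrices. -/
theorem exists_clifford (n : ℕ) : ∃ (D : ℕ) (_ : 0 < D)
    (Γ : (Fin n → ℝ) →ₗ[ℝ] Matrix (Fin D) (Fin D) ℂ),
    (∀ u, (Γ u).IsHermitian) ∧ ∀ u, Γ u * Γ u = (((∑ i, u i ^ 2 : ℝ) : ℂ)) • 1 := by
  obtain ⟨I, _, _, _, Γ, h1, h2⟩ := exists_clifford_of_fintype n
  refine ⟨Fintype.card I, Fintype.card_pos,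
    (Matrix.reindexLinearEquiv ℝ ℂ (Fintype.equivFin I) (Fintype.equivFin I)).toLinearMap ∘ₗ Γ,
    fun u => ?_, fun u => ?_⟩
  · simpa using (h1 u).submatrix (Fintype.equivFin I).symm
  · simp [Matrix.submatrix_mul_equiv, h2, Matrix.submatrix_smul]

/-- Polarization of the square relation, under the trace. -/
theorem clifford_trace_mul {n D : ℕ} {Γ : (Fin n → ℝ) →ₗ[ℝ] Matrix (Fin D) (Fin D) ℂ}
    (h : ∀ u, Γ u * Γ u = (((∑ i, u i ^ 2 : ℝ) : ℂ)) • 1) (u v : Fin n → ℝ) :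
    (Γ u * Γ v).trace = ((∑ i, u i * v i : ℝ) : ℂ) * D := by
  have h1 := congrArg Matrix.trace (h (u + v))
  have hu := congrArg Matrix.trace (h u)
  have hv := congrArg Matrix.trace (h v)
  have h2 : ∑ i, (u + v) i ^ 2 = ∑ i, u i ^ 2 + ∑ i, v i ^ 2 + 2 * ∑ i, u i * v i := by
    rw [Finset.mul_sum, ← Finset.sum_add_distrib, ← Finset.sum_add_distrib]
    refine Finset.sum_congr rfl fun i _ => ?_
    simp only [Pi.add_apply]
    ring
  rw [h2, map_add, add_mul, mul_add, mul_add] at h1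
  simp only [Matrix.trace_add, Matrix.trace_smul, Matrix.trace_one, Fintype.card_fin,
    smul_eq_mul, Complex.ofReal_add, Complex.ofReal_mul, Complex.ofReal_ofNat,
    Matrix.trace_mul_comm (Γ v) (Γ u)] at h1 hu hv
  linear_combination (1 / 2) * h1 - (1 / 2) * hu - (1 / 2) * hv

/-- The measurement operator for the outcome `a` of an observable with square `1`. -/
noncomputable def observableProj {D : ℕ} (A : Matrix (Fin D) (Fin D) ℂ) (a : Bool) :
    Matrix (Fin D) (Fin D) ℂ :=
  (1 / 2 : ℂ) • (1 + (bitSign a : ℂ) • A)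

/-- The operator is a Hermitian idempotent `P`, so `P = Pᴴ * P`. -/
theorem observableProj_posSemidef {D : ℕ} {A : Matrix (Fin D) (Fin D) ℂ} (hA : A.IsHermitian)
    (hA2 : A * A = 1) (a : Bool) : (observableProj A a).PosSemidef := by
  have h1 : (observableProj A a).conjTranspose = observableProj A a := by
    simp [observableProj, Matrix.conjTranspose_smul, hA.eq]
  have h2 : (observableProj A a).conjTranspose * observableProj A a = observableProj A a := by
    rw [h1]
    have hs : (bitSign a : ℂ) * bitSign a = 1 := by
      rw [← Complex.ofReal_mul, ← sq, bitSign_sq, Complex.ofReal_one]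
    simp only [observableProj, Matrix.smul_mul, Matrix.mul_smul, add_mul, mul_add, one_mul,
      mul_one, hA2, smul_smul, smul_add]
    match_scalars
    · linear_combination (1 / 4 : ℂ) * hs
    · ring
  rw [← h2]
  exact Matrix.posSemidef_conjTranspose_mul_self _

theorem observableProj_sum {D : ℕ} (A : Matrix (Fin D) (Fin D) ℂ) :
    ∑ a, observableProj A a = 1 := by
  simp only [Fintype.sum_bool, observableProj, bitSign]
  simp
  module

/-- The maximally entangled state on `ℂ^D ⊗ ℂ^D`. -/
noncomputable def maxEntangled (D : ℕ) : Matrix (Fin D × Fin D) (Fin D × Fin D) ℂ :=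
  (1 / D : ℂ) • Matrix.vecMulVec (fun p => if p.1 = p.2 then 1 else 0)
    (fun p => if p.1 = p.2 then 1 else 0)

theorem maxEntangled_posSemidef (D : ℕ) : (maxEntangled D).PosSemidef := by
  refine Matrix.PosSemidef.smul ?_ (by positivity)
  have h := Matrix.posSemidef_vecMulVec_self_star
    (fun p : Fin D × Fin D => if p.1 = p.2 then (1 : ℂ) else 0)
  have hs : star (fun p : Fin D × Fin D => if p.1 = p.2 then (1 : ℂ) else 0) =
      fun p => if p.1 = p.2 then 1 else 0 := by
    ext p
    simp [apply_ite]
  rwa [hs] at h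

theorem trace_maxEntangled_mul_kronecker {D : ℕ} (A B : Matrix (Fin D) (Fin D) ℂ) :
    (maxEntangled D * (A ⊗ₖ B.transpose)).trace = (1 / D : ℂ) * (A * B).trace := by
  rw [maxEntangled, Matrix.smul_mul, Matrix.trace_smul, smul_eq_mul]
  congr 1
  simp [Matrix.trace, Matrix.mul_apply, Matrix.vecMulVec_apply, Fintype.sum_prod_type]
  rw [Finset.sum_comm]

/-- Tsirelson's construction: Clifford observables on a maximally entangled state, transposed on
Bob's side. An XOR game sees only the sum over an answer pair and its negation; there the terms
linear in the observables cancel, so their traces are irrelevant. -/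
theorem exists_quantumStrategy {X Y : Type} [Fintype X] [Fintype Y] {N : ℕ}
    (u : X → EuclideanSpace ℝ (Fin N)) (v : Y → EuclideanSpace ℝ (Fin N))
    (hu : ∀ x, ‖u x‖ = 1) (hv : ∀ y, ‖v y‖ = 1) :
    ∃ S : QuantumStrategy X Y, ∀ a b x y,
      S.prob a b x y + S.prob (!a) (!b) x y =
        (1 + bitSign a * bitSign b * inner ℝ (u x) (v y)) / 2 := by
  obtain ⟨D, hD, Γ, h1, h2⟩ := exists_clifford N
  have hD' : (D : ℂ) ≠ 0 := by exact_mod_cast hD.ne'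
  have hsq : ∀ w : EuclideanSpace ℝ (Fin N), ‖w‖ = 1 → Γ w * Γ w = 1 := by
    intro w hw
    rw [h2]
    have : ∑ i, w i ^ 2 = 1 := by
      rw [← EuclideanSpace.real_norm_sq_eq, hw, one_pow]
    rw [this]
    simp
  have hT : ∀ {A : Matrix (Fin D) (Fin D) ℂ}, A * A = 1 → A.transpose * A.transpose = 1 := by
    intro A hA
    rw [← Matrix.transpose_mul, hA, Matrix.transpose_one]
  let S : QuantumStrategy X Y :=
    { dA := D
      dB := D
      state := maxEntangled D
      state_posSemidef := maxEntangled_posSemidef D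
      state_trace := by
        have := trace_maxEntangled_mul_kronecker (1 : Matrix (Fin D) (Fin D) ℂ) 1
        simpa [hD'] using this
      measA := fun x => observableProj (Γ (u x))
      measA_posSemidef := fun x => observableProj_posSemidef (h1 _) (hsq _ (hu x))
      measA_sum := fun x => observableProj_sum _
      measB := fun y => observableProj (Γ (v y)).transpose
      measB_posSemidef := fun y =>
        observableProj_posSemidef (h1 _).transpose (hT (hsq _ (hv y)))
      measB_sum := fun y => observableProj_sum _ }
  refine ⟨S, fun a b x y => ?_⟩
  have hp : ∀ a b, S.prob a b x y = ((1 / D : ℂ) *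
      (observableProj (Γ (u x)) a * observableProj (Γ (v y)) b).trace).re := by
    intro a b
    rw [← trace_maxEntangled_mul_kronecker]
    simp [QuantumStrategy.prob, S, observableProj]
  have hneg : ∀ a, bitSign (!a) = - bitSign a := fun a => by cases a <;> simp [bitSign]
  have htr := clifford_trace_mul h2 (u x) (v y)
  have hin : ∑ i, u x i * v y i = inner ℝ (u x) (v y) := by
    simp [PiLp.inner_apply, mul_comm]
  rw [hin] at htr
  rw [hp, hp, ← Complex.add_re, ← Complex.ofReal_re ((1 + _) / 2)]
  congr 1
  simp only [observableProj, hneg, Matrix.smul_mul, Matrix.mul_smul, add_mul, mul_add, one_mul,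
    mul_one, Matrix.trace_smul, Matrix.trace_add, Matrix.trace_one, htr, Fintype.card_fin, smul_eq_mul]
  push_cast
  field_simp
  ring

/-! ### Winning probabilities and the quantum bias -/

theorem winProb_eq_of_prob {X Y : Type} [Fintype X] [Fintype Y] (S : QuantumStrategy X Y)
    (f : X → Y → Bool) (μ : X × Y → ℝ) (hμ : ∑ x, ∑ y, μ (x, y) = 1) {c : X → Y → ℝ}
    (h : ∀ a b x y, S.prob a b x y + S.prob (!a) (!b) x y =
        (1 + bitSign a * bitSign b * c x y) / 2) :
    2 * S.winProb f μ - 1 = ∑ x, ∑ y, μ (x, y) * bitSign (f x y) * c x y := by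
  have h1 : ∀ x y, (∑ a : Bool, ∑ b : Bool, if xor a b = f x y then S.prob a b x y else 0) =
      (1 + bitSign (f x y) * c x y) / 2 := by
    intro x y
    have h2 := h false false x y
    have h3 := h false true x y
    cases f x y <;> simp [bitSign] at * <;> linarith
  simp only [QuantumStrategy.winProb, h1]
  calc _ = 2 * ∑ x, ∑ y, μ (x, y) * ((1 + bitSign (f x y) * c x y) / 2) -
        ∑ x, ∑ y, μ (x, y) := by rw [hμ]
    _ = _ := ?_
  rw [Finset.mul_sum, ← Finset.sum_sub_distrib]
  refine Finset.sum_congr rfl fun x _ => ?_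
  rw [Finset.mul_sum, ← Finset.sum_sub_distrib]
  refine Finset.sum_congr rfl fun y _ => by ring

theorem Matrix.PosSemidef.trace_mul_nonneg {I : Type} [Fintype I] {A B : Matrix I I ℂ}
    (hA : A.PosSemidef) (hB : B.PosSemidef) : 0 ≤ (A * B).trace := by
  obtain ⟨C, rfl⟩ := hB.exists_eq_conjTranspose_mul_self
  rw [← Matrix.mul_assoc, Matrix.trace_mul_comm, ← Matrix.mul_assoc]
  exact (hA.mul_mul_conjTranspose_same C).trace_nonneg

namespace QuantumStrategy

variable {X Y : Type}

theorem prob_nonneg (S : QuantumStrategy X Y) (a b : Bool) (x : X) (y : Y) :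
    0 ≤ S.prob a b x y :=
  (Complex.le_def.1 (S.state_posSemidef.trace_mul_nonneg
    ((S.measA_posSemidef x a).kronecker (S.measB_posSemidef y b)))).1

theorem sum_prob (S : QuantumStrategy X Y) (x : X) (y : Y) :
    ∑ a, ∑ b, S.prob a b x y = 1 := by
  have h : (∑ a, S.measA x a) ⊗ₖ (∑ b, S.measB y b) = 1 := by
    rw [S.measA_sum, S.measB_sum, Matrix.one_kronecker_one]
  have h2 : (S.state * ((∑ a, S.measA x a) ⊗ₖ (∑ b, S.measB y b))).trace.re = 1 := by
    rw [h, mul_one, S.state_trace, Complex.one_re]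
  rw [← h2]
  simp only [prob, Fintype.sum_bool, Matrix.add_kronecker, Matrix.kronecker_add, mul_add,
    Matrix.trace_add, Complex.add_re]
  ring

theorem winProb_le [Fintype X] [Fintype Y] (S : QuantumStrategy X Y) (f : X → Y → Bool)
    {μ : X × Y → ℝ} (hμ0 : ∀ p, 0 ≤ μ p) (hμ : ∑ x, ∑ y, μ (x, y) = 1) :
    S.winProb f μ ≤ 1 := by
  rw [← hμ, winProb]
  refine Finset.sum_le_sum fun x _ => Finset.sum_le_sum fun y _ =>
    mul_le_of_le_one_right (hμ0 _) ?_
  rw [← S.sum_prob x y]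
  refine Finset.sum_le_sum fun a _ => Finset.sum_le_sum fun b _ => ?_
  split_ifs
  · exact le_rfl
  · exact S.prob_nonneg a b x y

end QuantumStrategy

theorem le_quantumBias {X Y : Type} [Fintype X] [Fintype Y] (f : X → Y → Bool)
    {μ : X × Y → ℝ} (hμ0 : ∀ p, 0 ≤ μ p) (hμ : ∑ x, ∑ y, μ (x, y) = 1) {N : ℕ}
    (u : X → EuclideanSpace ℝ (Fin N)) (v : Y → EuclideanSpace ℝ (Fin N))
    (hu : ∀ x, ‖u x‖ = 1) (hv : ∀ y, ‖v y‖ = 1) :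
    ∑ x, ∑ y, μ (x, y) * bitSign (f x y) * inner ℝ (u x) (v y) ≤ quantumBias f μ := by
  obtain ⟨S, hS⟩ := exists_quantumStrategy u v hu hv
  rw [← winProb_eq_of_prob S f μ hμ hS]
  -- A real supremum dominates its members only when bounded above; here `1` is a bound.
  refine le_ciSup (f := fun S : QuantumStrategy X Y => 2 * S.winProb f μ - 1) ⟨1, ?_⟩ S
  rintro _ ⟨S, rfl⟩
  have := S.winProb_le f hμ0 hμ
  simp only
  linarith

/-- The error probability in terms of the correlation of the signs. -/
theorem sum_mul_bitSign_eq {X Y : Type} [Fintype X] [Fintype Y] (g f : X → Y → Bool)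
    {μ : X × Y → ℝ} (hμ : ∑ x, ∑ y, μ (x, y) = 1) :
    ∑ x, ∑ y, μ (x, y) * bitSign (f x y) * bitSign (g x y) = 1 - 2 * errorProb g f μ := by
  calc _ = ∑ x, ∑ y, μ (x, y) - 2 * errorProb g f μ := ?_
    _ = _ := by rw [hμ]
  rw [errorProb, Finset.mul_sum, ← Finset.sum_sub_distrib]
  refine Finset.sum_congr rfl fun x _ => ?_
  rw [Finset.mul_sum, ← Finset.sum_sub_distrib]
  refine Finset.sum_congr rfl fun y _ => ?_
  cases f x y <;> cases g x y <;> simp [bitSign] <;> ring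

/-! ### Blocks, XOR powers and the protocol bound -/

theorem bitSign_xorPow {n : ℕ} (f : BitString n → BitString n → Bool) (ℓ : ℕ)
    (x y : BitString (ℓ * n)) :
    bitSign (xorPow f ℓ x y) = ∏ i, bitSign (f (block x i) (block y i)) := by
  have h : ∀ L : List Bool, bitSign (L.foldr xor false) = (L.map bitSign).prod := by
    intro L
    induction L with
    | nil => simp [bitSign]
    | cons c L ih => simp [bitSign_xor, ih]
  rw [xorPow, h, List.map_ofFn, List.prod_ofFn]
  rfl

/-- A string of length `ℓ n` is the same as its family of blocks. -/
def blockEquiv (n ℓ : ℕ) : BitString (ℓ * n) ≃ (Fin ℓ → BitString n) :=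
  (Equiv.arrowCongr finProdFinEquiv.symm (Equiv.refl Bool)).trans (Equiv.curry _ _ _)

theorem blockEquiv_apply {n ℓ : ℕ} (x : BitString (ℓ * n)) (i : Fin ℓ) :
    blockEquiv n ℓ x i = block x i := rfl

theorem sum_prod_block {n ℓ : ℕ} (a : BitString n → ℝ) :
    ∑ x : BitString (ℓ * n), ∏ i : Fin ℓ, a (block x i) = (∑ x, a x) ^ ℓ := by
  have h := (blockEquiv n ℓ).sum_comp (fun z => ∏ i, a (z i))
  simp only [blockEquiv_apply] at h
  rw [h, Finset.sum_pow', Fintype.piFinset_univ]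

theorem sum_tensorPow {n : ℕ} {μ : BitString n × BitString n → ℝ}
    (hμ : ∑ x, ∑ y, μ (x, y) = 1) (ℓ : ℕ) : ∑ x, ∑ y, tensorPow μ ℓ (x, y) = 1 := by
  have h1 : ∀ x : BitString (ℓ * n), ∑ y, tensorPow μ ℓ (x, y) =
      ∏ i, ∑ y, μ (block x i, y) := by
    intro x
    have h := (blockEquiv n ℓ).sum_comp (fun z => ∏ i, μ (block x i, z i))
    simp only [blockEquiv_apply] at h
    rw [Finset.prod_univ_sum, Fintype.piFinset_univ, ← h]
    rfl
  simp only [h1]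
  rw [sum_prod_block (fun x => ∑ y, μ (x, y)), hμ, one_pow]

/-- A protocol whose output signs are products of local signs has bias at most
`√2 ^ cost * β ^ ℓ` on `f^{⊕ ℓ}`, where `β` is the quantum bias of `f`. -/
theorem exists_protocol_bound {n : ℕ} (f : BitString n → BitString n → Bool)
    {μ : BitString n × BitString n → ℝ} (hμ0 : ∀ p, 0 ≤ μ p)
    (hμ : ∑ x, ∑ y, μ (x, y) = 1) :
    0 < quantumBias f μ ∧ ∀ (ℓ : ℕ) {O : Type}
      (P : Protocol (BitString (ℓ * n)) (BitString (ℓ * n)) O)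
      (α : O → BitString (ℓ * n) → Bool) (β : O → BitString (ℓ * n) → Bool),
      1 - 2 * errorProb (fun x y => xor (α (P.run x y) x) (β (P.run x y) y))
        (xorPow f ℓ) (tensorPow μ ℓ) ≤ √2 ^ P.cost * quantumBias f μ ^ ℓ := by
  obtain ⟨N, u, v, a, b, hu, hv, ha, hb, hq⟩ :=
    exists_unit_vectors_and_dual (fun x y => μ (x, y) * bitSign (f x y))
  obtain ⟨g, k, hg, hga, hk, hkb, hgk⟩ := exists_gram_of_quadratic_le hq
  have ha0 : ∀ x, 0 ≤ a x := fun x => by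
    rw [← hga x]; exact Finset.sum_nonneg fun z _ => mul_self_nonneg _
  have hb0 : ∀ y, 0 ≤ b y := fun y => by
    rw [← hkb y]; exact Finset.sum_nonneg fun z _ => mul_self_nonneg _
  have hle := le_quantumBias f hμ0 hμ u v hu hv
  rw [← ha] at hle hb
  have hpos : 0 < ∑ x, a x := by
    -- Zero total weight would kill all vectors `g x`, hence `G` and with it `μ`.
    refine lt_of_le_of_ne (Finset.sum_nonneg fun x _ => ha0 x) fun h0 => ?_
    have hax : ∀ x, a x = 0 := fun x =>
      (Finset.sum_eq_zero_iff_of_nonneg fun x _ => ha0 x).1 h0.symm x (Finset.mem_univ x)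
    have hgz : ∀ x z, g x z = 0 := fun x z => by
      have := (Finset.sum_eq_zero_iff_of_nonneg fun z _ => mul_self_nonneg (g x z)).1
        ((hga x).trans (hax x)) z (Finset.mem_univ z)
      simpa using this
    have hG : ∀ x y, μ (x, y) = 0 := fun x y => by
      have h1 := hgk x y
      simp only [hgz, zero_mul, Finset.sum_const_zero] at h1
      have h2 := bitSign_sq (f x y)
      have h3 : μ (x, y) = μ (x, y) * bitSign (f x y) * bitSign (f x y) := by
        rw [mul_assoc, ← sq, h2, mul_one]
      rw [h3, ← h1, zero_mul]
    simp [hG] at hμ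
  refine ⟨hpos.trans_le hle, fun ℓ O P α β => ?_⟩
  have hinj : Function.Injective fun (x : BitString (ℓ * n)) (i : Fin ℓ) => block x i :=
    (blockEquiv n ℓ).injective
  have hF := FormBound.tensorPow_of_gram g k hg hga hk hkb hinj hinj
  -- At the all-ones vectors the form is the correlation with `f^{⊕ ℓ}`, and each weighted norm is
  -- the square root of `(∑ x, a x) ^ ℓ`.
  have hP := Protocol.formBound (α := fun o x => bitSign (α o x))
    (β := fun o y => bitSign (β o y))
    (fun x => Finset.prod_nonneg fun i _ => ha0 _)
    (fun y => Finset.prod_nonneg fun i _ => hb0 _) hF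
    (fun o x => (bitSign_sq _).le) (fun o y => (bitSign_sq _).le) P (fun _ => 1) (fun _ => 1)
  simp only [mul_one, one_pow, hgk, ← bitSign_xor, Finset.prod_mul_distrib,
    ← bitSign_xorPow] at hP
  rw [sum_prod_block, sum_prod_block, hb, Real.mul_self_sqrt (by positivity)] at hP
  rw [← sum_mul_bitSign_eq _ _ (sum_tensorPow hμ ℓ)]
  refine hP.trans ?_
  gcongr

/-! ### From correlation to communication -/

theorem logb_le_of_pow_le {ρ β : ℝ} (hρ : 0 < ρ) (hβ : 0 < β) {ℓ c : ℕ} (hℓ : 0 < ℓ)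
    (h : ρ ^ ℓ ≤ √2 ^ c * β ^ ℓ) : 2 * Real.logb 2 (ρ / β) ≤ 1 / (ℓ : ℝ) * c := by
  have h1 : (ρ / β) ^ ℓ ≤ √2 ^ c := by
    rw [div_pow]
    exact (div_le_iff₀ (by positivity)).2 h
  have h2 := Real.logb_le_logb_of_le (b := 2) (by norm_num) (by positivity) h1
  rw [Real.logb_pow, Real.logb_pow, Real.sqrt_eq_rpow, Real.logb_rpow (by norm_num) (by norm_num)]
    at h2
  have hℓ' : (0 : ℝ) < ℓ := by exact_mod_cast hℓ
  rw [one_div, ← div_eq_inv_mul, le_div_iff₀ hℓ']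
  linarith

theorem corollary1 {n : ℕ} (f : BitString n → BitString n → Bool)
    (μ : BitString n × BitString n → ℝ)
    (hμ : μ ∈ stdSimplex ℝ (BitString n × BitString n))
    (ℓ : ℕ) (hℓ : 0 < ℓ) (ρ : ℝ) (hρ_pos : 0 < ρ) (hρ_le : ρ ≤ 1) :
    0 < quantumBias f μ ∧
    (1 / (ℓ : ℝ)) * (commComplexity (ρ ^ ℓ) (xorPow f ℓ) (tensorPow μ ℓ) : ℝ) ≥
      2 * Real.logb 2 (ρ / quantumBias f μ) ∧
    (1 / (ℓ : ℝ)) * (xorCommComplexity (ρ ^ ℓ) (xorPow f ℓ) (tensorPow μ ℓ) : ℝ) ≥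
      2 * Real.logb 2 (ρ / quantumBias f μ) := by
  have hμ1 : ∑ x, ∑ y, μ (x, y) = 1 := by rw [← Fintype.sum_prod_type]; exact hμ.2
  obtain ⟨hpos, hbound⟩ := exists_protocol_bound f hμ.1 hμ1
  have hρ' : 0 ≤ (1 - ρ ^ ℓ) / 2 := by
    have := pow_le_one₀ hρ_pos.le hρ_le (n := ℓ)
    linarith
  refine ⟨hpos, ?_, ?_⟩
  · obtain ⟨P, hP, herr⟩ : commComplexity (ρ ^ ℓ) (xorPow f ℓ) (tensorPow μ ℓ) ∈
        {k : ℕ | ∃ P : Protocol _ _ Bool,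
          P.cost = k ∧ errorProb P.run (xorPow f ℓ) (tensorPow μ ℓ) ≤ (1 - ρ ^ ℓ) / 2} := by
      refine Nat.sInf_mem ?_
      obtain ⟨P, hP⟩ := Protocol.exists_run_eq (xorPow f ℓ) id
      exact ⟨_, P, rfl, by simpa [errorProb, hP] using hρ'⟩
    -- A leaf label is an XOR output in which Bob always answers `false`.
    have h := hbound ℓ P (fun o _ => o) (fun _ _ => false)
    simp only [Bool.xor_false] at h
    rw [← hP]
    exact logb_le_of_pow_le hρ_pos hpos hℓ (le_trans (by linarith) h)
  · obtain ⟨P, hP, herr⟩ : xorCommComplexity (ρ ^ ℓ) (xorPow f ℓ) (tensorPow μ ℓ) ∈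
        {k : ℕ | ∃ P : Protocol (BitString (ℓ * n)) (BitString (ℓ * n))
            ((BitString (ℓ * n) → Bool) × (BitString (ℓ * n) → Bool)),
          P.cost = k ∧ errorProb (fun x y => xor ((P.run x y).1 x) ((P.run x y).2 y))
            (xorPow f ℓ) (tensorPow μ ℓ) ≤ (1 - ρ ^ ℓ) / 2} := by
      refine Nat.sInf_mem ?_
      obtain ⟨P, hP⟩ := Protocol.exists_run_eq (Y := BitString (ℓ * n))
        (O := (BitString (ℓ * n) → Bool) × (BitString (ℓ * n) → Bool)) (xorPow f ℓ)
        fun c => (fun _ => c, fun _ => false)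
      exact ⟨_, P, rfl, by simpa [errorProb, hP] using hρ'⟩
    have h := hbound ℓ P (fun o => o.1) (fun o => o.2)
    rw [← hP]
    exact logb_le_of_pow_le hρ_pos hpos hℓ (le_trans (by linarith) h)
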